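/- Consider the degenerate diffusion equation $$u_t=\frac1{m+1}(u^{m+1})_{xx}+u^p(1-u)(u-a),\qquad t>0,\ x\in\mathbb R, \tag{1}$$ with $m=3/4$, $p=1/4$, $a=0.3$, and, for $c\in\mathbb R$, the desingularized traveling wave system $$\dot\varphi=\psi,\qquad \dot\psi=-c\psi-\varphi(1-\varphi)(\varphi-a),\qquad \dot{}=\frac{d}{dz}. \tag{2}$$ Put $d=1/(m+1)$ and $f(u)=u^p(1-u)(u-a)$. A nonnegative function $u$ is a weak solution of (1) with continuous initial datum $u_0$, $0\le u_0\le1$, if for all $r,T>0$ it is continuous and bounded on $(0,T)\times\mathbb R$ and $$\int_0^T\!\!\int_{-r}^r\{u\eta_t+du^{m+1}\eta_{xx}+f(u)\eta\}\,dx\,dt=\int_{-r}^r\{u(T,x)\eta(T,x)-u_0(x)\eta(0,x)\}\,dx+d\int_0^T\{u^{m+1}(t,r)\eta_x(t,r)-u^{m+1}(t,-r)\eta_x(t,-r)\}\,dt$$ for all $\eta\ge0$ of class $C^{2,1}$ ($C^2$ in $x$, $C^1$ in $t$) on $[0,T]\times\mathbb R$ with $\eta(t,\pm r)=0$ for $t\in[0,T]$.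 A compacton traveling wave with speed $c$ is a weak solution $u(t,x)=\phi(x-ct)$ with initial datum $\phi$, where $\phi\not\equiv0$ has compact support. Then there is $c_*\in 1.5\times10^{-6}\cdot[-1,1]$ such that the following holds. (i) System (2) with $c=c_*$ has a nontrivial orbit $(\varphi(z),\psi(z))$, $z\in\mathbb R$, homoclinic to $(0,0)$, with $\varphi>0$. (ii) There are finite $\xi_{\min}<\xi_{\max}$ and a function $\xi(z)$ with $d\xi/dz=\varphi(z)^{m}$, $\xi(z)\to\xi_{\min}$ as $z\to-\infty$ and $\xi(z)\to\xi_{\max}$ as $z\to+\infty$, such that the profile $\phi$ defined by $\phi(\xi(z))=\varphi(z)$ on $(\xi_{\min},\xi_{\max})$ and $\phi=0$ on $\mathbb R\setminus(\xi_{\min},\xi_{\max})$ gives a compacton traveling wave $u(t,x)=\phi(x-c_*t)$ of (1) with speed $c_*$. (iii) For every $t$, the support of $u(t,\cdot)$ is $[\xi_{\min}+c_*t,\ \xi_{\max}+c_*t]$, and $\xi_{\max}-\xi_{\min}=|\operatorname{supp}u(t,\cdot)|\in[5.7503277707,\ 5.8115725019]$. (iv) The linearization of (2) with $c=c_*$ at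 $(0,0)$ has eigenvectors $V_1$ (positive eigenvalue) and $V_2$ (negative eigenvalue) with $$V_1\in\begin{pmatrix}[0.87714184587409483,\,0.87714960434933953]\\ [0.48042765940975440,\,0.48043734031068247]\end{pmatrix},\quad V_2\in\begin{pmatrix}[-0.87714960433700939,\,-0.87714184587344934]\\ [0.48042765939685023,\,0.48043734034727664]\end{pmatrix}$$ such that $N=PB$, where $P=[V_1\ V_2]$ and $$B=\big([-1.0000068275040609,\,1.0000038705938853]\times10^{-6}\big)\times\big([-1.0000261784559085,\,1.0000461805915562]\times10^{-7}\big),$$ contains $(0,0)$ and is an isolating block for (2) with $c=c_*$. That is: $N$ is compact; every complete trajectory contained in $N$ lies in $\operatorname{int}N$; $\partial N$ is the union of the set of exit points and the set of entrance points; and the set of exit points is closed. Here $x\in\partial N$ is an exit (resp. entrance) point if every solution $\sigma$ with $\sigma(0)=x$ on an interval $[-\delta_1,\delta_2]$, $\delta_1\ge0$, $\delta_2>0$, satisfies $\sigma(t)\notin N$ (resp. $\sigma(t)\in\operatorname{int}N$) for all small $t>0$ and, if $\delta_1>0$, $\sigma(t)\notin\partial N$ (resp. $\sigma(t)\notin N$)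 for all $t<0$ close to $0$. -/

import Mathlib

open Set Filter Topology MeasureTheory

/-! ### Weak solutions of `u_t = d (u^(m+1))_xx + f(u)`, `d = 1/(m+1)`, on `(0,∞) × ℝ` -/

/-- `η` is a nonnegative test function of class `C^{2,1}` (twice continuously differentiable in the
space variable `x`, once in the time variable `t`) on the closed strip `[0,T] × ℝ`, vanishing on the
lines `x = r` and `x = -r`. The functions `ηt`, `ηx`, `ηxx` are its partial derivatives (one-sided in
`t` at the two ends of the time interval). Arguments are ordered as `(t, x)`. -/
structure IsC21TestFunction (T r : ℝ) (η ηt ηx ηxx : ℝ × ℝ → ℝ) : Prop where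
  cont : ContinuousOn η (Icc 0 T ×ˢ univ)
  cont_t : ContinuousOn ηt (Icc 0 T ×ˢ univ)
  cont_x : ContinuousOn ηx (Icc 0 T ×ˢ univ)
  cont_xx : ContinuousOn ηxx (Icc 0 T ×ˢ univ)
  deriv_t : ∀ t ∈ Icc 0 T, ∀ x, HasDerivWithinAt (fun s => η (s, x)) (ηt (t, x)) (Icc 0 T) t
  deriv_x : ∀ t ∈ Icc 0 T, ∀ x, HasDerivAt (fun y => η (t, y)) (ηx (t, x)) x
  deriv_xx : ∀ t ∈ Icc 0 T, ∀ x, HasDerivAt (fun y => ηx (t, y)) (ηxx (t, x)) x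
  nonneg : ∀ t ∈ Icc 0 T, ∀ x, 0 ≤ η (t, x)
  vanish_right : ∀ t ∈ Icc 0 T, η (t, r) = 0
  vanish_left : ∀ t ∈ Icc 0 T, η (t, -r) = 0

/-- `u = u(t,x)` is a weak solution of `u_t = d (u^(m+1))_xx + f(u)` on `(0,∞) × ℝ`, `d = 1/(m+1)`,
with the initial datum `u₀`, which is continuous with `0 ≤ u₀ ≤ 1`. -/
structure IsWeakSolution (m : ℝ) (f : ℝ → ℝ) (u₀ : ℝ → ℝ) (u : ℝ → ℝ → ℝ) : Prop where
  init_cont : Continuous u₀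
  init_mem : ∀ x, u₀ x ∈ Icc (0 : ℝ) 1
  nonneg : ∀ t, 0 < t → ∀ x, 0 ≤ u t x
  cont : ∀ T, 0 < T → ContinuousOn (fun q : ℝ × ℝ => u q.1 q.2) (Ioo 0 T ×ˢ univ)
  bounded : ∀ T, 0 < T → ∃ M, ∀ t ∈ Ioo 0 T, ∀ x, |u t x| ≤ M
  weak : ∀ r T, 0 < r → 0 < T → ∀ η ηt ηx ηxx, IsC21TestFunction T r η ηt ηx ηxx →
    (∫ q in Ioo 0 T ×ˢ Ioo (-r) r,
        (u q.1 q.2 * ηt q + 1 / (m + 1) * u q.1 q.2 ^ (m + 1) * ηxx q + f (u q.1 q.2) * η q))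
      = (∫ x in (-r)..r, (u T x * η (T, x) - u₀ x * η (0, x)))
        + 1 / (m + 1) *
          ∫ t in (0)..T, (u t r ^ (m + 1) * ηx (t, r) - u t (-r) ^ (m + 1) * ηx (t, -r))

/-- The profile `φ` is a compacton traveling wave with speed `c`: it is a nonzero compactly supported
function such that `u(t,x) = φ(x - c t)` is a weak solution (with initial datum `φ`). -/
structure IsCompacton (m : ℝ) (f : ℝ → ℝ) (c : ℝ) (φ : ℝ → ℝ) : Prop where
  weak_solution : IsWeakSolution m f φ (fun t x => φ (x - c * t))
  compact_support : HasCompactSupport φ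
  nontrivial : φ ≠ 0

/-- The reaction term `u^p (1 - u) (u - a)`. -/
noncomputable def reaction (p a : ℝ) (u : ℝ) : ℝ := u ^ p * (1 - u) * (u - a)

/-! ### The desingularized traveling wave system -/

/-- The vector field `φ' = ψ`, `ψ' = -c ψ - φ (1 - φ) (φ - a)`. -/
def desingField (a c : ℝ) (q : ℝ × ℝ) : ℝ × ℝ :=
  (q.2, -c * q.2 - q.1 * (1 - q.1) * (q.1 - a))

section Dynamics

variable {E : Type*} [NormedAddCommGroup E] [NormedSpace ℝ E]

/-- `σ` solves `σ' = F(σ)` on the time set `I` (one-sided derivatives at the ends of `I`). -/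
def SolvesOn (F : E → E) (I : Set ℝ) (σ : ℝ → E) : Prop :=
  ∀ t ∈ I, HasDerivWithinAt σ (F (σ t)) I t

/-- `γ` is a (nontrivial) orbit of `x' = F(x)` homoclinic to the equilibrium `p`. -/
structure IsHomoclinicOrbit (F : E → E) (p : E) (γ : ℝ → E) : Prop where
  equilibrium : F p = 0
  solves : SolvesOn F univ γ
  nonconst : ∃ z, γ z ≠ p
  tendsto_bot : Tendsto γ atBot (𝓝 p)
  tendsto_top : Tendsto γ atTop (𝓝 p)

/-- The maximal invariant set in `N`: points lying on a complete trajectory inside `N`. -/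
def invariantPart (F : E → E) (N : Set E) : Set E :=
  {x | ∃ γ : ℝ → E, SolvesOn F univ γ ∧ γ 0 = x ∧ ∀ t, γ t ∈ N}

/-- Exit points of `N`. -/
def exitSet (F : E → E) (N : Set E) : Set E :=
  {x | x ∈ frontier N ∧ ∀ δ₁ δ₂ : ℝ, 0 ≤ δ₁ → 0 < δ₂ → ∀ σ : ℝ → E,
    SolvesOn F (Icc (-δ₁) δ₂) σ → σ 0 = x →
    (∃ ε₂ > 0, ε₂ ≤ δ₂ ∧ ∀ t, 0 < t → t ≤ ε₂ → σ t ∉ N) ∧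
    (0 < δ₁ → ∃ ε₁ > 0, ε₁ ≤ δ₁ ∧ ∀ t, -ε₁ ≤ t → t < 0 → σ t ∉ frontier N)}

/-- Entrance points of `N`. -/
def entranceSet (F : E → E) (N : Set E) : Set E :=
  {x | x ∈ frontier N ∧ ∀ δ₁ δ₂ : ℝ, 0 ≤ δ₁ → 0 < δ₂ → ∀ σ : ℝ → E,
    SolvesOn F (Icc (-δ₁) δ₂) σ → σ 0 = x →
    (∃ ε₂ > 0, ε₂ ≤ δ₂ ∧ ∀ t, 0 < t → t ≤ ε₂ → σ t ∈ interior N) ∧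
    (0 < δ₁ → ∃ ε₁ > 0, ε₁ ≤ δ₁ ∧ ∀ t, -ε₁ ≤ t → t < 0 → σ t ∉ N)}

/-- `N` is an isolating block for `x' = F(x)`. -/
structure IsIsolatingBlock (F : E → E) (N : Set E) : Prop where
  compact : IsCompact N
  isolating : invariantPart F N ⊆ interior N
  frontier_eq : frontier N = exitSet F N ∪ entranceSet F N
  exit_closed : IsClosed (exitSet F N)

end Dynamics

/-! The speed can be taken to be exactly 0. System (2) is then Hamiltonian, and on its zero energy
level `w = 1/φ` satisfies `w'² = 0.3 w² - (2.6/3) w + 1/2`. This is solved by `w = (13 + √34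
cosh(√0.3 z))/9`, so the homoclinic orbit is explicit (`isHomoclinicOrbit_orbit`).

Since `dξ = φ^(3/4) dz` and `m + p = 1`, along the orbit `(φ^(7/4))_ξ = (7/4) ψ` and its derivative
is `-(7/4) f(φ)`. Both tend to 0 at the two ends, so `φ^(7/4)` extended by zero is C² and solves the
stationary equation classically. Integration by parts gives the weak form (`hasDerivAt_extend_zero`,
`isWeakSolution_stationary`).

The width is the integral of `φ^(3/4)` over the line. With `t = exp(-√0.3 z/4)` it becomes `8/√0.3`
times an integral over `[0,1]`, which convexity encloses between integrals of polynomials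
(`integral_widthDensity_bounds`).

For the block, the linear part at the origin is diagonal in eigencoordinates with eigenvalues
`±√0.3`. On so small a box the nonlinearity cannot change the sign of the flow through any face, and
a polytope with strictly transversal faces is an isolating block (`isIsolatingBlock_polytope`). -/

/-! ### Enclosure of the width integral -/

/-- Weighted AM-GM, via `log x ≤ x - 1`. It encodes the convexity of `x ↦ x^(-3/4)` without real
powers. -/
theorem seven_le_of_one_le_pow_mul_pow {u v : ℝ} (hu : 0 < u) (hv : 0 < v)
    (h : 1 ≤ u ^ 4 * v ^ 3) : 7 ≤ 4 * u + 3 * v := by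
  have h1 := Real.log_le_sub_one_of_pos hu
  have h2 := Real.log_le_sub_one_of_pos hv
  have h3 := Real.log_nonneg h
  rw [Real.log_mul (by positivity) (by positivity), Real.log_pow, Real.log_pow] at h3
  push_cast at h3
  linarith

/-- Tangent line bound for the function `x ↦ (c / x) ^ (3 / 4)`. -/
theorem tangent_le_of_pow_mul_pow_eq {c x y d e : ℝ} (hx : 0 < x) (hy : 0 < y) (hd : 0 < d)
    (he : 0 < e) (h : c ≤ y ^ 4 * x ^ 3) (h' : e ^ 4 * d ^ 3 ≤ c) :
    e * (7 - 3 * x / d) / 4 ≤ y := by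
  have h1 : 1 ≤ (y / e) ^ 4 * (x / d) ^ 3 := by
    rw [div_pow, div_pow, div_mul_div_comm, one_le_div (by positivity)]
    linarith
  have h2 := seven_le_of_one_le_pow_mul_pow (by positivity) (by positivity) h1
  have h3 : e * (7 - 3 * (x / d)) ≤ e * (4 * (y / e)) :=
    mul_le_mul_of_nonneg_left (by linarith) he.le
  rw [show e * (4 * (y / e)) = 4 * y by field_simp] at h3
  rw [mul_div_assoc 3 x d]
  linarith

/-- Chord bound for the function `x ↦ (c / x) ^ (3 / 4)`. -/
theorem le_chord_of_pow_mul_pow_eq {c x y a b A B : ℝ} (ha : 0 < a) (hx : 0 < x) (hy : 0 < y)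
    (hax : a ≤ x) (hxb : x ≤ b) (hab : a < b) (hA : 0 < A) (hB : 0 < B) (h : y ^ 4 * x ^ 3 ≤ c)
    (h1 : c ≤ A ^ 4 * a ^ 3) (h2 : c ≤ B ^ 4 * b ^ 3) :
    y ≤ ((b - x) * A + (x - a) * B) / (b - a) := by
  have k1 := tangent_le_of_pow_mul_pow_eq ha hA hx hy h1 h
  have k2 := tangent_le_of_pow_mul_pow_eq (ha.trans hab) hB hx hy h2 h
  rw [le_div_iff₀ (by linarith)]
  have e1 := mul_le_mul_of_nonneg_left k1 (sub_nonneg.2 hxb)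
  have e2 := mul_le_mul_of_nonneg_left k2 (sub_nonneg.2 hax)
  -- The line of height `y` and slope `-3y/(4x)` at `x`, evaluated at `a` and `b`, averages back to
  -- `y` at `x`.
  have : (b - x) * (y * (7 - 3 * a / x) / 4) + (x - a) * (y * (7 - 3 * b / x) / 4)
      = y * (b - a) := by field_simp; ring
  linarith

/-- The denominator `√34 (t⁸ + 1) + 26 t⁴` of the homoclinic orbit, with a parameter in place of
`√34`. -/
def denBound (s t : ℝ) : ℝ := s * (t ^ 8 + 1) + 26 * t ^ 4

theorem denBound_pos {s : ℝ} (hs : 0 < s) (t : ℝ) : 0 < denBound s t := by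
  unfold denBound; positivity

theorem denBound_mono_left {s s' : ℝ} (h : s ≤ s') (t : ℝ) : denBound s t ≤ denBound s' t := by
  unfold denBound; gcongr

theorem denBound_le {s a b : ℝ} (hs : 0 < s) (ha : 0 ≤ a) (hab : a ≤ b) :
    denBound s a ≤ denBound s b := by
  unfold denBound; gcongr

/-- The density `φ ^ (3 / 4) / t` of the width of the compacton, where `φ = 18 t⁴ / denBound √34 t` is
the homoclinic orbit in the time variable `t = exp (-√0.3 z / 4)`. -/
noncomputable def widthDensity (t : ℝ) : ℝ := t ^ 2 * (18 / denBound (√34) t) ^ (3 / 4 : ℝ)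

theorem continuous_widthDensity : Continuous widthDensity := by
  have h : ∀ t, denBound (√34) t ≠ 0 := fun t => (denBound_pos (by positivity) t).ne'
  have h' : Continuous (denBound (√34)) := by unfold denBound; fun_prop
  unfold widthDensity
  refine (continuous_pow 2).mul (Continuous.rpow_const (continuous_const.div h' h) ?_)
  intro t; right; norm_num

theorem sqrt_thirty_four_mem : √34 ∈ Icc (5.8309 : ℝ) 5.831 :=
  ⟨Real.le_sqrt_of_sq_le (by norm_num), Real.sqrt_le_iff.2 (by norm_num)⟩

theorem rpow_three_quarters_pow_four {x : ℝ} (hx : 0 ≤ x) : (x ^ (3 / 4 : ℝ)) ^ 4 = x ^ 3 := by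
  rw [← Real.rpow_natCast, ← Real.rpow_mul hx, ← Real.rpow_natCast]; norm_num

theorem integral_sq_mul_denBound (s α β a b : ℝ) :
    ∫ t in a..b, t ^ 2 * (α + β * denBound s t) =
      α * ((b ^ 3 - a ^ 3) / 3) + β * (s * ((b ^ 11 - a ^ 11) / 11 + (b ^ 3 - a ^ 3) / 3)
        + 26 * ((b ^ 7 - a ^ 7) / 7)) := by
  have : ∀ x ∈ uIcc a b, HasDerivAt (fun t => α * (t ^ 3 / 3)
      + β * (s * (t ^ 11 / 11 + t ^ 3 / 3) + 26 * (t ^ 7 / 7))) (x ^ 2 * (α + β * denBound s x)) x := by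
    intro x _
    have p : ∀ n : ℕ, HasDerivAt (fun t : ℝ => t ^ n) (n * x ^ (n - 1)) x := hasDerivAt_pow (x := x)
    refine ((((p 3).div_const 3).const_mul α).add
      (((((p 11).div_const 11).add ((p 3).div_const 3)).const_mul s).add
        (((p 7).div_const 7).const_mul 26) |>.const_mul β)).congr_deriv ?_
    unfold denBound; push_cast; ring
  rw [intervalIntegral.integral_eq_sub_of_hasDerivAt this
    (Continuous.intervalIntegrable (by unfold denBound; fun_prop) _ _)]
  ring

/-- The density is `t²` times a convex decreasing function of the denominator. The tangent at
denominator value `d` bounds it below and the chord between the endpoint values bounds it above.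
Both are affine in the denominator, hence polynomial in `t`; `√34` is rounded up for the lower bound
and down for the upper one. -/
theorem integral_widthDensity_mem {a b A B d y : ℝ} (ha : 0 ≤ a) (hab : a < b) (hA : 0 < A)
    (hB : 0 < B) (hd : 0 < d) (hy : 0 < y) (h1 : 18 ^ 3 ≤ A ^ 4 * denBound 5.8309 a ^ 3)
    (h2 : 18 ^ 3 ≤ B ^ 4 * denBound 5.8309 b ^ 3) (h3 : y ^ 4 * d ^ 3 ≤ 18 ^ 3) :
    (∫ t in a..b, widthDensity t) ∈
      Icc (7 * y / 4 * ((b ^ 3 - a ^ 3) / 3)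
        - 3 * y / (4 * d) * (5.831 * ((b ^ 11 - a ^ 11) / 11 + (b ^ 3 - a ^ 3) / 3)
        + 26 * ((b ^ 7 - a ^ 7) / 7)))
      ((denBound 5.8309 b * A - denBound 5.8309 a * B) / (denBound 5.8309 b - denBound 5.8309 a)
          * ((b ^ 3 - a ^ 3) / 3)
        + (B - A) / (denBound 5.8309 b - denBound 5.8309 a)
          * (5.8309 * ((b ^ 11 - a ^ 11) / 11 + (b ^ 3 - a ^ 3) / 3)
        + 26 * ((b ^ 7 - a ^ 7) / 7))) := by
  have hs := sqrt_thirty_four_mem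
  have hint : IntervalIntegrable widthDensity volume a b :=
    continuous_widthDensity.intervalIntegrable _ _
  have hint' : ∀ s α β : ℝ,
      IntervalIntegrable (fun t => t ^ 2 * (α + β * denBound s t)) volume a b := fun s α β =>
    Continuous.intervalIntegrable (by unfold denBound; fun_prop) _ _
  have hpos : ∀ t, 0 < denBound (√34) t := denBound_pos (by positivity)
  have hgt : ∀ t, ((18 / denBound (√34) t) ^ (3 / 4 : ℝ)) ^ 4 = 18 ^ 3 / denBound (√34) t ^ 3 :=
    fun t => by
      rw [rpow_three_quarters_pow_four (by have := hpos t; positivity), div_pow]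
  have hlt : denBound 5.8309 a < denBound 5.8309 b := by
    unfold denBound; gcongr
  constructor
  · have := integral_sq_mul_denBound 5.831 (7 * y / 4) (-(3 * y / (4 * d))) a b
    rw [neg_mul, ← sub_eq_add_neg] at this
    rw [← this]
    refine intervalIntegral.integral_mono_on hab.le (hint' _ _ _) hint fun t ht => ?_
    refine mul_le_mul_of_nonneg_left ?_ (sq_nonneg t)
    have hp := hpos t
    refine le_trans (le_of_eq ?_) (tangent_le_of_pow_mul_pow_eq (c := 18 ^ 3)
      (x := denBound 5.831 t) (denBound_pos (by norm_num) t) (by positivity) hd hy ?_ h3)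
    · field_simp; ring
    · rw [hgt, div_mul_eq_mul_div, le_div_iff₀ (by positivity)]
      gcongr
      exact denBound_mono_left hs.2 t
  · rw [← integral_sq_mul_denBound]
    refine intervalIntegral.integral_mono_on hab.le hint (hint' _ _ _) fun t ht => ?_
    refine mul_le_mul_of_nonneg_left ?_ (sq_nonneg t)
    have hp := hpos t
    refine le_trans (le_chord_of_pow_mul_pow_eq (c := 18 ^ 3) (x := denBound 5.8309 t)
      (denBound_pos (by norm_num) a) (denBound_pos (by norm_num) t) (by positivity)
      (denBound_le (by norm_num) ha ht.1) (denBound_le (by norm_num) (ha.trans ht.1) ht.2) hlt hA hB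
      ?_ h1 h2) (le_of_eq ?_)
    · have := denBound_pos (show (0 : ℝ) < 5.8309 by norm_num) t
      rw [hgt, div_mul_eq_mul_div, div_le_iff₀ (by positivity)]
      gcongr
      exact denBound_mono_left hs.1 t
    · have : denBound 5.8309 b - denBound 5.8309 a ≠ 0 := by linarith
      field_simp; ring

theorem integral_widthDensity_bounds :
    (∫ t in (0 : ℝ)..1, widthDensity t) ∈ Icc (0.3945 : ℝ) 0.3975 := by
  -- `A` and `B` are `(18/den)^(3/4)` at the endpoints rounded up, `d` is a value of the denominator
  -- inside the piece, and `y` is `(18/d)^(3/4)` rounded down.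
  have h0 := integral_widthDensity_mem (a := 0) (b := 0.46) (A := 2.32891) (B := 2.02917) (d := 6.332) (y := 2.18926)
    (by norm_num) (by norm_num) (by norm_num) (by norm_num) (by norm_num) (by norm_num)
    (by norm_num [denBound]) (by norm_num [denBound]) (by norm_num)
  have h1 := integral_widthDensity_mem (a := 0.46) (b := 0.56) (A := 2.02917) (B := 1.76414) (d := 7.698) (y := 1.89091)
    (by norm_num) (by norm_num) (by norm_num) (by norm_num) (by norm_num) (by norm_num)
    (by norm_num [denBound]) (by norm_num [denBound]) (by norm_num)
  have h2 := integral_widthDensity_mem (a := 0.56) (b := 0.63) (A := 1.76414) (B := 1.54575) (d := 9.237) (y := 1.64932)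
    (by norm_num) (by norm_num) (by norm_num) (by norm_num) (by norm_num) (by norm_num)
    (by norm_num [denBound]) (by norm_num [denBound]) (by norm_num)
  have h3 := integral_widthDensity_mem (a := 0.63) (b := 0.7) (A := 1.54575) (B := 1.32171) (d := 11.21) (y := 1.42642)
    (by norm_num) (by norm_num) (by norm_num) (by norm_num) (by norm_num) (by norm_num)
    (by norm_num [denBound]) (by norm_num [denBound]) (by norm_num)
  have h4 := integral_widthDensity_mem (a := 0.7) (b := 0.75) (A := 1.32171) (B := 1.16754) (d := 13.504) (y := 1.24053)
    (by norm_num) (by norm_num) (by norm_num) (by norm_num) (by norm_num) (by norm_num)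
    (by norm_num [denBound]) (by norm_num [denBound]) (by norm_num)
  have h5 := integral_widthDensity_mem (a := 0.75) (b := 0.81) (A := 1.16754) (B := 0.99571) (d := 16.331) (y := 1.0757)
    (by norm_num) (by norm_num) (by norm_num) (by norm_num) (by norm_num) (by norm_num)
    (by norm_num [denBound]) (by norm_num [denBound]) (by norm_num)
  have h6 := integral_widthDensity_mem (a := 0.81) (b := 0.86) (A := 0.99571) (B := 0.86626) (d := 19.913) (y := 0.92704)
    (by norm_num) (by norm_num) (by norm_num) (by norm_num) (by norm_num) (by norm_num)
    (by norm_num [denBound]) (by norm_num [denBound]) (by norm_num)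
  have h7 := integral_widthDensity_mem (a := 0.86) (b := 0.91) (A := 0.86626) (B := 0.75028) (d := 24.051) (y := 0.80464)
    (by norm_num) (by norm_num) (by norm_num) (by norm_num) (by norm_num) (by norm_num)
    (by norm_num [denBound]) (by norm_num [denBound]) (by norm_num)
  have h8 := integral_widthDensity_mem (a := 0.91) (b := 0.95) (A := 0.75028) (B := 0.66717) (d := 28.599) (y := 0.70662)
    (by norm_num) (by norm_num) (by norm_num) (by norm_num) (by norm_num) (by norm_num)
    (by norm_num [denBound]) (by norm_num [denBound]) (by norm_num)
  have h9 := integral_widthDensity_mem (a := 0.95) (b := 1) (A := 0.66717) (B := 0.57482) (d := 34.19) (y := 0.61805)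
    (by norm_num) (by norm_num) (by norm_num) (by norm_num) (by norm_num) (by norm_num)
    (by norm_num [denBound]) (by norm_num [denBound]) (by norm_num)
  have hi : ∀ a b, IntervalIntegrable widthDensity volume a b := fun a b =>
    continuous_widthDensity.intervalIntegrable _ _
  have hadd : ∀ b c, (∫ t in (0 : ℝ)..c, widthDensity t)
      = (∫ t in (0 : ℝ)..b, widthDensity t) + ∫ t in b..c, widthDensity t := fun b c =>
    (intervalIntegral.integral_add_adjacent_intervals (hi _ _) (hi _ _)).symm
  norm_num [denBound] at h0 h1 h2 h3 h4 h5 h6 h7 h8 h9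
  rw [hadd (19 / 20) 1, hadd (91 / 100) (19 / 20), hadd (43 / 50) (91 / 100),
    hadd (81 / 100) (43 / 50), hadd (3 / 4) (81 / 100), hadd (7 / 10) (3 / 4),
    hadd (63 / 100) (7 / 10), hadd (14 / 25) (63 / 100), hadd (23 / 50) (14 / 25)]
  constructor <;> linarith [h0.1, h0.2, h1.1, h1.2, h2.1, h2.2, h3.1, h3.2, h4.1, h4.2, h5.1, h5.2,
    h6.1, h6.2, h7.1, h7.2, h8.1, h8.2, h9.1, h9.2]

/-! ### Isolating blocks in the shape of a polytope -/

theorem HasDerivWithinAt.eventually_lt_and_lt {f : ℝ → ℝ} {f' : ℝ} {I : Set ℝ} {a : ℝ}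
    (h : HasDerivWithinAt f f' I a) (hf' : 0 < f') :
    ∀ᶠ t in 𝓝[I] a, (a < t → f a < f t) ∧ (t < a → f t < f a) := by
  rw [hasDerivWithinAt_iff_tendsto_slope] at h
  have h1 : ∀ᶠ t in 𝓝[I \ {a}] a, 0 < slope f a t := h.eventually (lt_mem_nhds hf')
  rw [sdiff_eq, nhdsWithin_inter', eventually_inf_principal] at h1
  filter_upwards [h1] with t ht
  constructor
  · intro hat
    have := ht (by simpa using hat.ne')
    rw [slope_def_field] at this
    have := (div_pos_iff_of_pos_right (sub_pos.2 hat)).1 this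
    linarith
  · intro hat
    have := ht (by simpa using hat.ne)
    rw [slope_def_field] at this
    rcases div_pos_iff.1 this with h2 | h2 <;> linarith

theorem exists_pos_forall_of_eventually_nhdsWithin {δ₁ δ₂ : ℝ} {P : ℝ → Prop}
    (h : ∀ᶠ t in 𝓝[Icc (-δ₁) δ₂] 0, P t) :
    ∃ ε > 0, ∀ t ∈ Icc (-δ₁) δ₂, |t| ≤ ε → P t := by
  obtain ⟨ε, hε, h⟩ := (nhdsWithin_hasBasis Metric.nhds_basis_closedBall _).eventually_iff.1 h
  exact ⟨ε, hε, fun t ht h' => h ⟨by simpa using h', ht⟩⟩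

section Polytope

variable {E : Type*} [NormedAddCommGroup E] [NormedSpace ℝ E]

theorem interior_polytope {ι : Type*} [Finite ι] (ℓ : ι → E →L[ℝ] ℝ) (β : ι → ℝ)
    (hℓ : ∀ i, ℓ i ≠ 0) : interior {x | ∀ i, ℓ i x ≤ β i} = {x | ∀ i, ℓ i x < β i} := by
  have h1 : {x | ∀ i, ℓ i x ≤ β i} = ⋂ i, ℓ i ⁻¹' Iic (β i) := by ext; simp
  have h2 : {x | ∀ i, ℓ i x < β i} = ⋂ i, ℓ i ⁻¹' Iio (β i) := by ext; simp
  rw [h1, h2, interior_iInter_of_finite]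
  refine iInter_congr fun i => ?_
  rw [← ((ℓ i).isOpenMap_of_ne_zero (hℓ i)).preimage_interior_eq_interior_preimage
    (ℓ i).continuous, interior_Iic]

theorem isClosed_polytope {ι : Type*} (ℓ : ι → E →L[ℝ] ℝ) (β : ι → ℝ) :
    IsClosed {x | ∀ i, ℓ i x ≤ β i} := by
  rw [show {x | ∀ i, ℓ i x ≤ β i} = ⋂ i, ℓ i ⁻¹' Iic (β i) by ext; simp]
  exact isClosed_iInter fun i => isClosed_Iic.preimage (ℓ i).continuous

theorem frontier_polytope {ι : Type*} [Finite ι] (ℓ : ι → E →L[ℝ] ℝ) (β : ι → ℝ)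
    (hℓ : ∀ i, ℓ i ≠ 0) :
    frontier {x | ∀ i, ℓ i x ≤ β i} = {x | (∀ i, ℓ i x ≤ β i) ∧ ∃ i, ℓ i x = β i} := by
  rw [(isClosed_polytope ℓ β).frontier_eq, interior_polytope ℓ β hℓ]
  ext x
  simp only [Set.mem_sdiff, mem_ofPred_eq, not_forall, not_lt]
  exact and_congr_right fun h => exists_congr fun i => ⟨fun h' => le_antisymm (h i) h', fun h' => h'.ge⟩

/-- A complete trajectory through a boundary point leaves `N` forwards at an exit point and
backwards at an entrance point. -/
theorem invariantPart_subset_interior {F : E → E} {N : Set E} (hN : IsClosed N)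
    (h : frontier N = exitSet F N ∪ entranceSet F N) : invariantPart F N ⊆ interior N := by
  rintro x ⟨γ, hγ, rfl, hγN⟩
  by_contra hx
  have hfr : γ 0 ∈ frontier N := hN.frontier_eq ▸ ⟨hγN 0, hx⟩
  have hs : SolvesOn F (Icc (-1) 1) γ := fun t _ => (hγ t trivial).mono (subset_univ _)
  rw [h] at hfr
  rcases hfr with ⟨-, hx⟩ | ⟨-, hx⟩
  · obtain ⟨⟨ε, hε, -, h1⟩, -⟩ := hx 1 1 zero_le_one one_pos γ hs rfl
    exact h1 ε hε le_rfl (hγN _)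
  · obtain ⟨-, h1⟩ := hx 1 1 zero_le_one one_pos γ hs rfl
    obtain ⟨ε, hε, -, h1⟩ := h1 one_pos
    exact h1 (-ε) le_rfl (by linarith) (hγN _)

/-- Both definitions quantify over all solutions, so they conflict only once a solution exists.
Local existence for C¹ fields supplies one. -/
theorem disjoint_exitSet_entranceSet [CompleteSpace E] {F : E → E} (hF : ContDiff ℝ 1 F)
    (N : Set E) : Disjoint (exitSet F N) (entranceSet F N) := by
  rw [Set.disjoint_left]
  rintro x ⟨-, h1⟩ ⟨-, h2⟩
  obtain ⟨σ, h0, ε, hε, hσ⟩ :=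
    (hF.contDiffAt (x := x)).exists_forall_mem_closedBall_exists_eq_forall_mem_Ioo_hasDerivAt₀ 0
  have hs : SolvesOn F (Icc (-0) (ε / 2)) σ := fun t ht =>
    (hσ t ⟨by linarith [ht.1], by linarith [ht.2]⟩).hasDerivWithinAt
  obtain ⟨⟨a, ha, -, h1⟩, -⟩ := h1 0 (ε / 2) le_rfl (by linarith) σ hs h0
  obtain ⟨⟨b, hb, -, h2⟩, -⟩ := h2 0 (ε / 2) le_rfl (by linarith) σ hs h0
  exact h1 (min a b) (lt_min ha hb) (min_le_left _ _)
    (interior_subset (h2 (min a b) (lt_min ha hb) (min_le_right _ _)))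

variable {ι : Type*} [Finite ι] {F : E → E} {ℓ : ι → E →L[ℝ] ℝ} {β : ι → ℝ}

theorem eventually_lt_of_solvesOn {δ₁ δ₂ : ℝ} (h1 : 0 ≤ δ₁) (h2 : 0 < δ₂) {σ : ℝ → E}
    (hσ : SolvesOn F (Icc (-δ₁) δ₂) σ) (ℓ : E →L[ℝ] ℝ) (hℓ : 0 < ℓ (F (σ 0))) :
    ∀ᶠ t in 𝓝[Icc (-δ₁) δ₂] 0, (0 < t → ℓ (σ 0) < ℓ (σ t)) ∧ (t < 0 → ℓ (σ t) < ℓ (σ 0)) :=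
  (ℓ.hasFDerivAt.comp_hasDerivWithinAt 0
    (hσ 0 ⟨by linarith, h2.le⟩)).eventually_lt_and_lt hℓ

theorem eventually_lt_of_solvesOn_of_neg {δ₁ δ₂ : ℝ} (h1 : 0 ≤ δ₁) (h2 : 0 < δ₂) {σ : ℝ → E}
    (hσ : SolvesOn F (Icc (-δ₁) δ₂) σ) (ℓ : E →L[ℝ] ℝ) (hℓ : ℓ (F (σ 0)) < 0) :
    ∀ᶠ t in 𝓝[Icc (-δ₁) δ₂] 0, (0 < t → ℓ (σ t) < ℓ (σ 0)) ∧ (t < 0 → ℓ (σ 0) < ℓ (σ t)) := by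
  filter_upwards [eventually_lt_of_solvesOn h1 h2 hσ (-ℓ) (by simpa using hℓ)] with t ht
  simpa using ht

theorem eventually_inactive {δ₁ δ₂ : ℝ} (h1 : 0 ≤ δ₁) (h2 : 0 < δ₂) {σ : ℝ → E}
    (hσ : SolvesOn F (Icc (-δ₁) δ₂) σ) (ℓ : E →L[ℝ] ℝ) {b : ℝ} (hℓ : ℓ (σ 0) < b) :
    ∀ᶠ t in 𝓝[Icc (-δ₁) δ₂] 0, ℓ (σ t) < b :=
  (ℓ.continuous.continuousAt.comp_continuousWithinAt
    (hσ 0 ⟨by linarith, h2.le⟩).continuousWithinAt).eventually (gt_mem_nhds hℓ)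

theorem mem_exitSet_polytope (hℓ : ∀ i, ℓ i ≠ 0) {S : Set ι}
    (hout : ∀ x, (∀ i, ℓ i x ≤ β i) → ∀ i ∈ S, ℓ i x = β i → 0 < ℓ i (F x))
    (hin : ∀ x, (∀ i, ℓ i x ≤ β i) → ∀ i ∉ S, ℓ i x = β i → ℓ i (F x) < 0)
    {x : E} (hx : ∀ i, ℓ i x ≤ β i) {i : ι} (hi : i ∈ S) (hxi : ℓ i x = β i) :
    x ∈ exitSet F {x | ∀ i, ℓ i x ≤ β i} := by
  refine ⟨frontier_polytope ℓ β hℓ ▸ ⟨hx, i, hxi⟩, fun δ₁ δ₂ h1 h2 σ hσ hσ0 => ?_⟩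
  subst hσ0
  constructor
  · obtain ⟨ε, hε, h⟩ := exists_pos_forall_of_eventually_nhdsWithin
      (eventually_lt_of_solvesOn h1 h2 hσ (ℓ i) (hout _ hx i hi hxi))
    refine ⟨min ε δ₂, lt_min hε h2, min_le_right _ _, fun t ht ht' hN => ?_⟩
    have := (h t ⟨by linarith, ht'.trans (min_le_right _ _)⟩
      (by rw [abs_of_pos ht]; exact ht'.trans (min_le_left _ _))).1 ht
    exact absurd (hN i) (by linarith)
  · intro hδ
    suffices H : ∀ᶠ t in 𝓝[Icc (-δ₁) δ₂] 0,
        t < 0 → σ t ∉ frontier {x | ∀ i, ℓ i x ≤ β i} by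
      obtain ⟨ε, hε, h⟩ := exists_pos_forall_of_eventually_nhdsWithin H
      refine ⟨min ε δ₁, lt_min hε hδ, min_le_right _ _, fun t ht ht' => ?_⟩
      exact h t ⟨by linarith [min_le_right ε δ₁], by linarith⟩
        (by rw [abs_of_neg ht']; linarith [min_le_left ε δ₁]) ht'
    rw [frontier_polytope ℓ β hℓ]
    -- At a point also on an inward face, the backward solution is already outside `N`. Otherwise
    -- all active faces are outward ones and it lies in the interior. Either way it avoids the
    -- frontier.
    by_cases hj : ∃ j ∉ S, ℓ j (σ 0) = β j
    · obtain ⟨j, hj, hxj⟩ := hj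
      filter_upwards [eventually_lt_of_solvesOn_of_neg h1 h2 hσ (ℓ j) (hin _ hx j hj hxj)]
        with t ht ht' hN
      exact absurd (hN.1 j) (by linarith [ht.2 ht'])
    · push Not at hj
      have : ∀ k, ∀ᶠ t in 𝓝[Icc (-δ₁) δ₂] 0, t < 0 → ℓ k (σ t) < β k := by
        intro k
        rcases (hx k).lt_or_eq with hk | hk
        · exact (eventually_inactive h1 h2 hσ (ℓ k) hk).mono fun _ h _ => h
        · have hkS : k ∈ S := by_contra fun h => hj k h hk
          filter_upwards [eventually_lt_of_solvesOn h1 h2 hσ (ℓ k) (hout _ hx k hkS hk)]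
            with t ht ht'
          exact hk ▸ ht.2 ht'
      filter_upwards [eventually_all.2 this] with t ht ht'
      rintro ⟨-, k, hk⟩
      exact (ht k ht').ne hk

theorem mem_entranceSet_polytope (hℓ : ∀ i, ℓ i ≠ 0)
    {x : E} (hx : ∀ i, ℓ i x ≤ β i) {i : ι} (hxi : ℓ i x = β i)
    (hin : ∀ i, ℓ i x = β i → ℓ i (F x) < 0) :
    x ∈ entranceSet F {x | ∀ i, ℓ i x ≤ β i} := by
  refine ⟨frontier_polytope ℓ β hℓ ▸ ⟨hx, i, hxi⟩, fun δ₁ δ₂ h1 h2 σ hσ hσ0 => ?_⟩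
  subst hσ0
  have h3 := eventually_lt_of_solvesOn_of_neg h1 h2 hσ (ℓ i) (hin i hxi)
  have : ∀ k, ∀ᶠ t in 𝓝[Icc (-δ₁) δ₂] 0, 0 < t → ℓ k (σ t) < β k := by
    intro k
    rcases (hx k).lt_or_eq with hk | hk
    · exact (eventually_inactive h1 h2 hσ (ℓ k) hk).mono fun _ h _ => h
    · filter_upwards [eventually_lt_of_solvesOn_of_neg h1 h2 hσ (ℓ k) (hin k hk)] with t ht ht'
      exact hk ▸ ht.1 ht'
  obtain ⟨ε, hε, h⟩ :=
    exists_pos_forall_of_eventually_nhdsWithin (h3.and (eventually_all.2 this))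
  constructor
  · refine ⟨min ε δ₂, lt_min hε h2, min_le_right _ _, fun t ht ht' => ?_⟩
    rw [interior_polytope ℓ β hℓ]
    exact fun k => (h t ⟨by linarith, ht'.trans (min_le_right _ _)⟩
      (by rw [abs_of_pos ht]; exact ht'.trans (min_le_left _ _))).2 k ht
  · intro hδ
    refine ⟨min ε δ₁, lt_min hε hδ, min_le_right _ _, fun t ht ht' hN => ?_⟩
    have := (h t ⟨by linarith [min_le_right ε δ₁], by linarith⟩
        (by rw [abs_of_neg ht']; linarith [min_le_left ε δ₁])).1.2 ht'
    exact absurd (hN i) (by linarith)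

/-- A polytope such that the vector field points strictly outwards on the facets in `S` and strictly
inwards on the other facets is an isolating block. -/
theorem isIsolatingBlock_polytope [CompleteSpace E] (hF : ContDiff ℝ 1 F) (hℓ : ∀ i, ℓ i ≠ 0)
    (S : Set ι) (hc : IsCompact {x | ∀ i, ℓ i x ≤ β i})
    (hout : ∀ x, (∀ i, ℓ i x ≤ β i) → ∀ i ∈ S, ℓ i x = β i → 0 < ℓ i (F x))
    (hin : ∀ x, (∀ i, ℓ i x ≤ β i) → ∀ i ∉ S, ℓ i x = β i → ℓ i (F x) < 0) :
    IsIsolatingBlock F {x | ∀ i, ℓ i x ≤ β i} := by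
  have key : ∀ x ∈ frontier {x | ∀ i, ℓ i x ≤ β i},
      (x ∈ exitSet F {x | ∀ i, ℓ i x ≤ β i} ∧ ∃ i ∈ S, ℓ i x = β i) ∨
        x ∈ entranceSet F {x | ∀ i, ℓ i x ≤ β i} := by
    rw [frontier_polytope ℓ β hℓ]
    rintro x ⟨hx, i, hi⟩
    by_cases h : ∃ j ∈ S, ℓ j x = β j
    · obtain ⟨j, hj, hxj⟩ := h
      exact .inl ⟨mem_exitSet_polytope hℓ hout hin hx hj hxj, j, hj, hxj⟩
    · push Not at h
      exact .inr (mem_entranceSet_polytope hℓ hx hi fun k hk =>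
        hin x hx k (fun hkS => h k hkS hk) hk)
  have hfr : frontier {x | ∀ i, ℓ i x ≤ β i} = exitSet F {x | ∀ i, ℓ i x ≤ β i} ∪
      entranceSet F {x | ∀ i, ℓ i x ≤ β i} :=
    Subset.antisymm (fun x hx => (key x hx).imp_left And.left)
      (union_subset (fun x hx => hx.1) fun x hx => hx.1)
  refine ⟨hc, invariantPart_subset_interior hc.isClosed hfr, hfr, ?_⟩
  -- The exit set is exactly the union of the closed outward faces, including their common points
  -- with inward faces; hence it is closed.
  have hex : exitSet F {x | ∀ i, ℓ i x ≤ β i} =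
      {x | ∀ i, ℓ i x ≤ β i} ∩ ⋃ i ∈ S, {x | ℓ i x = β i} := by
    ext x
    simp only [mem_inter_iff, mem_iUnion, exists_prop]
    constructor
    · intro hx
      refine ⟨hc.isClosed.frontier_subset hx.1, ?_⟩
      rcases key x hx.1 with h | h
      · exact h.2
      · exact absurd h (Set.disjoint_left.1 (disjoint_exitSet_entranceSet hF _) hx)
    · rintro ⟨hx, i, hi, hxi⟩
      exact mem_exitSet_polytope hℓ hout hin hx hi hxi
  rw [hex]
  exact hc.isClosed.inter (S.toFinite.isClosed_biUnion fun i _ =>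
    isClosed_eq (ℓ i).continuous continuous_const)

end Polytope

/-! ### The isolating block at the origin for speed zero -/

theorem desingField_zero (a : ℝ) (q : ℝ × ℝ) :
    desingField a 0 q = (q.2, a * q.1 - (1 + a) * q.1 ^ 2 + q.1 ^ 3) := by
  ext <;> simp only [desingField]
  ring

theorem contDiff_desingField (a c : ℝ) {n : WithTop ℕ∞} : ContDiff ℝ n (desingField a c) := by
  unfold desingField; fun_prop

theorem fderiv_desingField_zero (a : ℝ) (v : ℝ × ℝ) :
    fderiv ℝ (desingField a 0) (0, 0) v = (v.2, a * v.1) := by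
  have h : HasFDerivAt (desingField a 0) ((ContinuousLinearMap.snd ℝ ℝ ℝ).prod
      (a • ContinuousLinearMap.fst ℝ ℝ ℝ)) (0, 0) := by
    have h1 : HasFDerivAt (fun q : ℝ × ℝ => q.1) (ContinuousLinearMap.fst ℝ ℝ ℝ) (0, 0) :=
      hasFDerivAt_fst
    have h2 : HasFDerivAt (fun q : ℝ × ℝ => q.2) (ContinuousLinearMap.snd ℝ ℝ ℝ) (0, 0) :=
      hasFDerivAt_snd
    rw [show desingField a 0 = _ from funext (desingField_zero a)]
    refine h2.prodMk (((h1.const_mul a).sub ((h1.pow 2).const_mul (1 + a))).add (h1.pow 3)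
      |>.congr_fderiv ?_)
    ext <;> simp
  rw [h.fderiv]
  rfl

theorem hasEigenvector_desingField_zero {a l s : ℝ} (hl : l ^ 2 = a) (hs : s ≠ 0) :
    Module.End.HasEigenvector
      (fderiv ℝ (desingField a 0) (0, 0) : ℝ × ℝ →ₗ[ℝ] ℝ × ℝ) l (s, s * l) := by
  refine ⟨Module.End.mem_eigenspace_iff.2 ?_, fun h => hs (congrArg Prod.fst h)⟩
  rw [ContinuousLinearMap.coe_coe, fderiv_desingField_zero]
  ext
  · simp [mul_comm]
  · simp [← hl]; ring

/-- The coordinate along `(s, s l)` in the basis `(s, s l)`, `(-s, s l)`. -/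
noncomputable def unstableCoord (s l : ℝ) : ℝ × ℝ →L[ℝ] ℝ :=
  (2 * s)⁻¹ • (ContinuousLinearMap.fst ℝ ℝ ℝ + l⁻¹ • ContinuousLinearMap.snd ℝ ℝ ℝ)

/-- The coordinate along `(-s, s l)` in the basis `(s, s l)`, `(-s, s l)`. -/
noncomputable def stableCoord (s l : ℝ) : ℝ × ℝ →L[ℝ] ℝ :=
  (2 * s)⁻¹ • (l⁻¹ • ContinuousLinearMap.snd ℝ ℝ ℝ - ContinuousLinearMap.fst ℝ ℝ ℝ)

theorem unstableCoord_apply (s l : ℝ) (x : ℝ × ℝ) :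
    unstableCoord s l x = (x.1 + x.2 / l) / (2 * s) := by
  simp [unstableCoord]; ring

theorem stableCoord_apply (s l : ℝ) (x : ℝ × ℝ) :
    stableCoord s l x = (x.2 / l - x.1) / (2 * s) := by
  simp [stableCoord]; ring

section Coord

variable {s l : ℝ} (hs : s ≠ 0) (hl : l ≠ 0)
include hs hl

theorem unstableCoord_basis (b : ℝ × ℝ) :
    unstableCoord s l (b.1 • ((s, s * l) : ℝ × ℝ) + b.2 • ((-s, s * l) : ℝ × ℝ)) = b.1 := by
  rw [unstableCoord_apply]; simp; field_simp; ring

theorem stableCoord_basis (b : ℝ × ℝ) :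
    stableCoord s l (b.1 • ((s, s * l) : ℝ × ℝ) + b.2 • ((-s, s * l) : ℝ × ℝ)) = b.2 := by
  rw [stableCoord_apply]; simp; field_simp; ring

theorem basis_coord (x : ℝ × ℝ) :
    unstableCoord s l x • ((s, s * l) : ℝ × ℝ) + stableCoord s l x • ((-s, s * l) : ℝ × ℝ)
      = x := by
  rw [unstableCoord_apply, stableCoord_apply]
  ext <;> simp <;> field_simp <;> ring

theorem unstableCoord_ne_zero : unstableCoord s l ≠ 0 := fun h => by
  simpa [h] using unstableCoord_basis hs hl (1, 0)

theorem stableCoord_ne_zero : stableCoord s l ≠ 0 := fun h => by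
  simpa [h] using stableCoord_basis hs hl (0, 1)

theorem image_box_eq_polytope (a₁ b₁ a₂ b₂ : ℝ) :
    (fun b : ℝ × ℝ => b.1 • ((s, s * l) : ℝ × ℝ) + b.2 • ((-s, s * l) : ℝ × ℝ)) ''
        (Icc (-a₁) b₁ ×ˢ Icc (-a₂) b₂) =
      {x | ∀ i, (![unstableCoord s l, -unstableCoord s l, stableCoord s l, -stableCoord s l] :
        Fin 4 → ℝ × ℝ →L[ℝ] ℝ) i x ≤ (![b₁, a₁, b₂, a₂] : Fin 4 → ℝ) i} := by
  ext x
  simp only [mem_image, mem_prod, mem_Icc, mem_ofPred_eq, Fin.forall_fin_succ]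
  simp
  constructor
  · rintro ⟨b, c, ⟨⟨h1, h2⟩, h3, h4⟩, rfl⟩
    have e1 := unstableCoord_basis hs hl (b, c)
    have e2 := stableCoord_basis hs hl (b, c)
    simp at e1 e2
    rw [e1, e2]
    exact ⟨h2, by linarith, h4, by linarith⟩
  · rintro ⟨h1, h2, h3, h4⟩
    refine ⟨_, _, ⟨⟨?_, h1⟩, ?_, h3⟩, by simpa using basis_coord hs hl x⟩ <;> linarith

omit hs in
-- The linear part is diagonal in these coordinates; the same quadratic and cubic remainder appears
-- in both of them.
theorem unstableCoord_desingField {a : ℝ} (ha : l ^ 2 = a) (x : ℝ × ℝ) :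
    unstableCoord s l (desingField a 0 x) =
      l * unstableCoord s l x + (x.1 ^ 3 - (1 + a) * x.1 ^ 2) / (2 * s * l) := by
  rw [unstableCoord_apply, unstableCoord_apply, desingField_zero, ← ha]
  field_simp; ring

omit hs in
theorem stableCoord_desingField {a : ℝ} (ha : l ^ 2 = a) (x : ℝ × ℝ) :
    stableCoord s l (desingField a 0 x) =
      -l * stableCoord s l x + (x.1 ^ 3 - (1 + a) * x.1 ^ 2) / (2 * s * l) := by
  rw [stableCoord_apply, stableCoord_apply, desingField_zero, ← ha]
  field_simp; ring

/-- A box in eigencoordinates is an isolating block for speed zero as soon as the nonlinear terms are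
dominated by the linear ones on its faces. -/
theorem isIsolatingBlock_desingField_zero {a : ℝ} (ha : l ^ 2 = a) {a₁ b₁ a₂ b₂ η : ℝ}
    (hη : ∀ u ∈ Icc (-a₁) b₁, ∀ v ∈ Icc (-a₂) b₂,
      |((s * (u - v)) ^ 3 - (1 + a) * (s * (u - v)) ^ 2) / (2 * s * l)| < η)
    (h1 : η ≤ l * a₁) (h2 : η ≤ l * b₁) (h3 : η ≤ l * a₂) (h4 : η ≤ l * b₂) :
    IsIsolatingBlock (desingField a 0)
      ((fun b : ℝ × ℝ => b.1 • ((s, s * l) : ℝ × ℝ) + b.2 • ((-s, s * l) : ℝ × ℝ)) ''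
        (Icc (-a₁) b₁ ×ˢ Icc (-a₂) b₂)) := by
  have hc : IsCompact ((fun b : ℝ × ℝ => b.1 • ((s, s * l) : ℝ × ℝ) +
      b.2 • ((-s, s * l) : ℝ × ℝ)) '' (Icc (-a₁) b₁ ×ˢ Icc (-a₂) b₂)) :=
    (isCompact_Icc.prod isCompact_Icc).image (by fun_prop)
  have hu := unstableCoord_ne_zero hs hl
  have hv := stableCoord_ne_zero hs hl
  rw [image_box_eq_polytope hs hl] at hc ⊢
  have key : ∀ x : ℝ × ℝ, (∀ i, (![unstableCoord s l, -unstableCoord s l, stableCoord s l,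
      -stableCoord s l] : Fin 4 → ℝ × ℝ →L[ℝ] ℝ) i x ≤ (![b₁, a₁, b₂, a₂] : Fin 4 → ℝ) i) →
      |(x.1 ^ 3 - (1 + a) * x.1 ^ 2) / (2 * s * l)| < η := by
    intro x hx
    have e : x.1 = s * (unstableCoord s l x - stableCoord s l x) := by
      rw [unstableCoord_apply, stableCoord_apply]; field_simp; ring
    have g0 := hx 0
    have g1 := hx 1
    have g2 := hx 2
    have g3 := hx 3
    simp at g0 g1 g2 g3
    rw [e]
    exact hη _ ⟨by linarith, g0⟩ _ ⟨by linarith, g2⟩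
  refine isIsolatingBlock_polytope (contDiff_desingField a 0) ?_ {0, 1} hc ?_ ?_
  · intro i
    fin_cases i <;> simp [hu, hv]
  · intro x hx i hi hxi
    have hk := abs_lt.1 (key x hx)
    rcases hi with rfl | rfl <;> simp at hxi <;>
      simp [unstableCoord_desingField hl ha]
    · rw [hxi]; linarith
    · rw [show unstableCoord s l x = -a₁ by linarith]; linarith
  · intro x hx i hi hxi
    have hk := abs_lt.1 (key x hx)
    fin_cases i
    · simp at hi
    · simp at hi
    · simp at hxi
      simp [stableCoord_desingField hl ha]
      rw [hxi]; linarith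
    · simp at hxi
      simp [stableCoord_desingField hl ha]
      rw [show stableCoord s l x = -a₂ by linarith]; linarith

end Coord

theorem sqrt_three_tenths_mem : √(0.3 : ℝ) ∈ Icc (0.547722 : ℝ) 0.547723 :=
  ⟨Real.le_sqrt_of_sq_le (by norm_num), Real.sqrt_le_iff.2 (by norm_num)⟩

theorem isIsolatingBlock_desingField_numeric :
    IsIsolatingBlock (desingField 0.3 0)
      ((fun b : ℝ × ℝ => b.1 • ((0.877145, 0.877145 * √0.3) : ℝ × ℝ)
          + b.2 • ((-0.877145, 0.877145 * √0.3) : ℝ × ℝ)) ''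
        (Icc (-(1.0000068275040609 / 10 ^ 6)) (1.0000038705938853 / 10 ^ 6) ×ˢ
          Icc (-(1.0000261784559085 / 10 ^ 7)) (1.0000461805915562 / 10 ^ 7))) := by
  obtain ⟨hl1, hl2⟩ := sqrt_three_tenths_mem
  have hl : (0 : ℝ) < √0.3 := by linarith
  -- The remainder is of order `10⁻¹⁰` even with the crude bound `10⁻⁵` on the first coordinate,
  -- while the linear term on the faces is at least about `5·10⁻⁸`. Any `η` in between works.
  refine isIsolatingBlock_desingField_zero (η := 1 / 10 ^ 8) (by norm_num) hl.ne'
    (Real.sq_sqrt (by norm_num)) ?_ ?_ ?_ ?_ ?_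
  · rintro u ⟨hu1, hu2⟩ v ⟨hv1, hv2⟩
    have hw : |0.877145 * (u - v)| ≤ 1 / 10 ^ 5 := by
      rw [abs_le]; constructor <;> linarith
    set w := 0.877145 * (u - v)
    have h3 : |w ^ 3| ≤ (1 / 10 ^ 5) ^ 3 := by rw [abs_pow]; gcongr
    have h2 : |w ^ 2| ≤ (1 / 10 ^ 5) ^ 2 := by rw [abs_pow]; gcongr
    rw [abs_le] at h2 h3
    rw [abs_div, abs_of_pos (show 0 < 2 * 0.877145 * √0.3 by positivity),
      div_lt_iff₀ (by positivity), abs_lt]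
    constructor <;> linarith
  all_goals linarith

/-! ### The homoclinic orbit for speed zero -/

/-- First component of the homoclinic orbit. -/
noncomputable def orbitPos (z : ℝ) : ℝ := 9 / (13 + √34 * Real.cosh (√0.3 * z))

/-- Second component of the homoclinic orbit. -/
noncomputable def orbitVel (z : ℝ) : ℝ :=
  -(9 * (√34 * (√0.3 * Real.sinh (√0.3 * z)))) / (13 + √34 * Real.cosh (√0.3 * z)) ^ 2

theorem orbitDen_pos (z : ℝ) : 0 < 13 + √34 * Real.cosh (√0.3 * z) := by
  have := Real.cosh_pos (√0.3 * z); positivity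

theorem orbitPos_pos (z : ℝ) : 0 < orbitPos z := div_pos (by norm_num) (orbitDen_pos z)

theorem orbitPos_le_one (z : ℝ) : orbitPos z ≤ 1 := by
  rw [orbitPos, div_le_one (orbitDen_pos z)]
  have := Real.cosh_pos (√0.3 * z)
  have : 0 ≤ √34 * Real.cosh (√0.3 * z) := by positivity
  linarith

theorem orbitPos_neg (z : ℝ) : orbitPos (-z) = orbitPos z := by
  simp [orbitPos]

theorem hasDerivAt_orbitDen (z : ℝ) :
    HasDerivAt (fun z => 13 + √34 * Real.cosh (√0.3 * z))
      (√34 * (√0.3 * Real.sinh (√0.3 * z))) z := by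
  have h : HasDerivAt (fun z => √0.3 * z) (√0.3) z := by
    simpa using (hasDerivAt_id z).const_mul (√0.3)
  refine ((h.cosh.const_mul (√34)).const_add 13).congr_deriv ?_
  ring

theorem hasDerivAt_orbitPos (z : ℝ) : HasDerivAt orbitPos (orbitVel z) z :=
  ((hasDerivAt_const z 9).div (hasDerivAt_orbitDen z) (orbitDen_pos z).ne').congr_deriv
    (by rw [orbitVel]; ring)

/-- The second-order equation for the orbit, with `C`, `S` standing for cosh and sinh. Eliminating
`S` leaves a rational identity in the denominator `D = 13 + r C` alone. -/
theorem orbit_identity {r k C S : ℝ} (hr : r ^ 2 = 34) (hk : k ^ 2 = 0.3) (hS : S ^ 2 = C ^ 2 - 1)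
    (hD : 13 + r * C ≠ 0) :
    (-(9 * (r * (k * (C * k)))) * (13 + r * C) ^ 2
      + 9 * (r * (k * S)) * (2 * (13 + r * C) * (r * (k * S)))) / ((13 + r * C) ^ 2) ^ 2
      = -(9 / (13 + r * C) * (1 - 9 / (13 + r * C)) * (9 / (13 + r * C) - 0.3)) := by
  have e : -(9 * (r * (k * (C * k)))) * (13 + r * C) ^ 2
      + 9 * (r * (k * S)) * (2 * (13 + r * C) * (r * (k * S)))
      = -(9 * 0.3 * (r * C)) * (13 + r * C) ^ 2
      + 18 * 0.3 * (13 + r * C) * ((r * C) ^ 2 - 34) := by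
    rw [← hr, ← hk]
    linear_combination (18 * (13 + r * C) * r ^ 2 * k ^ 2) * hS
  rw [e]
  generalize hd : 13 + r * C = D at *
  rw [show r * C = D - 13 by linarith]
  field_simp
  ring

theorem hasDerivAt_orbitVel (z : ℝ) :
    HasDerivAt orbitVel (-(orbitPos z * (1 - orbitPos z) * (orbitPos z - 0.3))) z := by
  have h : HasDerivAt (fun z => √0.3 * z) (√0.3) z := by
    simpa using (hasDerivAt_id z).const_mul (√0.3)
  have hD := (orbitDen_pos z).ne'
  refine (((((h.sinh).const_mul (√0.3)).const_mul (√34)).const_mul 9).fun_neg.fun_div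
    ((hasDerivAt_orbitDen z).fun_pow 2) (pow_ne_zero 2 hD)).congr_deriv ?_
  refine Eq.trans ?_ (orbit_identity (Real.sq_sqrt (by norm_num)) (Real.sq_sqrt (by norm_num))
    (Real.sinh_sq (√0.3 * z)) hD)
  congr 1
  push_cast
  ring

theorem tendsto_orbitPos_atTop : Tendsto orbitPos atTop (𝓝 0) := by
  have hk : 0 < √(0.3 : ℝ) := by positivity
  have h1 : Tendsto (fun z => √34 / 2 * (√(0.3 : ℝ) * z)) atTop atTop :=
    (tendsto_id.const_mul_atTop hk).const_mul_atTop (by positivity)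
  refine Tendsto.const_div_atTop (tendsto_atTop_mono (fun z => ?_) h1) 9
  have h2 : √(0.3 : ℝ) * z / 2 ≤ Real.cosh (√0.3 * z) := by
    rw [Real.cosh_eq]
    linarith [Real.add_one_le_exp (√(0.3 : ℝ) * z), Real.exp_pos (-(√(0.3 : ℝ) * z))]
  have := mul_le_mul_of_nonneg_left h2 (Real.sqrt_nonneg 34)
  linarith

theorem tendsto_orbitPos_atBot : Tendsto orbitPos atBot (𝓝 0) := by
  have := tendsto_orbitPos_atTop.comp tendsto_neg_atBot_atTop
  exact this.congr orbitPos_neg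

/-- Follows from `|sinh| ≤ cosh` and `√0.3 ≤ 1`; it makes the velocity inherit the decay of the
position. -/
theorem abs_orbitVel_le (z : ℝ) : |orbitVel z| ≤ orbitPos z := by
  have hD := orbitDen_pos z
  have hk : √(0.3 : ℝ) ≤ 1 := by linarith [sqrt_three_tenths_mem.2]
  have hS : |Real.sinh (√0.3 * z)| ≤ Real.cosh (√0.3 * z) :=
    abs_le_of_sq_le_sq (by nlinarith [Real.cosh_sq (√0.3 * z)]) (Real.cosh_pos _).le
  rw [orbitVel, orbitPos, abs_div, abs_neg, abs_of_pos (pow_pos hD 2),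
    div_le_div_iff₀ (pow_pos hD 2) hD, abs_mul, abs_mul, abs_mul, abs_of_pos (by norm_num : (0:ℝ) < 9),
    abs_of_nonneg (Real.sqrt_nonneg _), abs_of_nonneg (Real.sqrt_nonneg _)]
  have h1 : √34 * (√0.3 * |Real.sinh (√0.3 * z)|) ≤ √34 * (1 * Real.cosh (√0.3 * z)) := by
    gcongr
  nlinarith

theorem tendsto_orbitVel {l : Filter ℝ} (h : Tendsto orbitPos l (𝓝 0)) :
    Tendsto orbitVel l (𝓝 0) :=
  squeeze_zero_norm abs_orbitVel_le h

theorem isHomoclinicOrbit_orbit :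
    IsHomoclinicOrbit (desingField 0.3 0) (0, 0) fun z => (orbitPos z, orbitVel z) where
  equilibrium := by simp [desingField]
  solves := fun t _ => by
    refine (((hasDerivAt_orbitPos t).prodMk (hasDerivAt_orbitVel t)).congr_deriv
      ?_).hasDerivWithinAt
    simp [desingField]
  nonconst := ⟨0, fun h => (orbitPos_pos 0).ne' (congrArg Prod.fst h)⟩
  tendsto_bot := tendsto_orbitPos_atBot.prodMk_nhds (tendsto_orbitVel tendsto_orbitPos_atBot)
  tendsto_top := tendsto_orbitPos_atTop.prodMk_nhds (tendsto_orbitVel tendsto_orbitPos_atTop)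

/-! ### The change of variables -/

/-- Half the width of the compacton. -/
noncomputable def halfWidth : ℝ := 4 / √0.3 * ∫ t in (0 : ℝ)..1, widthDensity t

/-- The original space variable along the homoclinic orbit. -/
noncomputable def spaceVar (z : ℝ) : ℝ :=
  halfWidth - 4 / √0.3 * ∫ t in (0 : ℝ)..Real.exp (-(√0.3 * z / 4)), widthDensity t

theorem hasDerivAt_integral_widthDensity (t : ℝ) :
    HasDerivAt (fun x => ∫ s in (0 : ℝ)..x, widthDensity s) (widthDensity t) t :=
  intervalIntegral.integral_hasDerivAt_right (continuous_widthDensity.intervalIntegrable _ _)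
    (continuous_widthDensity.stronglyMeasurableAtFilter _ _) continuous_widthDensity.continuousAt

/-- The factor `t` compensates `dt/dz = -(√0.3/4) t`, so this is the substitution formula behind
`spaceVar`. -/
theorem exp_mul_widthDensity (z : ℝ) :
    Real.exp (-(√0.3 * z / 4)) * widthDensity (Real.exp (-(√0.3 * z / 4)))
      = orbitPos z ^ (3 / 4 : ℝ) := by
  have ht := Real.exp_pos (-(√0.3 * z / 4))
  have hc : Real.cosh (√0.3 * z) = (Real.exp (-(√0.3 * z / 4)) ^ 4
      + (Real.exp (-(√0.3 * z / 4)) ^ 4)⁻¹) / 2 := by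
    rw [← Real.exp_nat_mul, ← Real.exp_neg, Real.cosh_eq, add_comm]
    congr 3 <;> push_cast <;> ring_nf
  rw [orbitPos, hc, widthDensity]
  set t := Real.exp (-(√0.3 * z / 4))
  have hD := denBound_pos (show 0 < √34 by positivity) t
  have h3 : t * t ^ 2 = (t ^ 4) ^ (3 / 4 : ℝ) := by
    rw [← Real.rpow_natCast t 4, ← Real.rpow_mul ht.le]
    norm_num
    ring
  rw [← mul_assoc, h3, ← Real.mul_rpow (by positivity) (by positivity)]
  congr 1
  unfold denBound at *
  field_simp
  ring

theorem hasDerivAt_spaceVar (z : ℝ) : HasDerivAt spaceVar (orbitPos z ^ (3 / 4 : ℝ)) z := by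
  have h : HasDerivAt (fun z => -(√0.3 * z / 4)) (-(√0.3 / 4)) z := by
    simpa using (((hasDerivAt_id z).const_mul (√0.3)).div_const 4).fun_neg
  refine ((((hasDerivAt_integral_widthDensity _).comp z h.exp).const_mul
    (4 / √0.3)).const_sub halfWidth).congr_deriv ?_
  rw [← exp_mul_widthDensity]
  have : √(0.3 : ℝ) ≠ 0 := by positivity
  field_simp

theorem tendsto_spaceVar_atTop : Tendsto spaceVar atTop (𝓝 halfWidth) := by
  have h1 : Tendsto (fun z => Real.exp (-(√0.3 * z / 4))) atTop (𝓝 0) :=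
    Real.tendsto_exp_neg_atTop_nhds_zero.comp
      ((tendsto_id.const_mul_atTop (by positivity)).atTop_div_const (by norm_num))
  have h2 := (hasDerivAt_integral_widthDensity 0).continuousAt.tendsto.comp h1
  have h3 := (h2.const_mul (4 / √0.3)).const_sub halfWidth
  rwa [intervalIntegral.integral_same, mul_zero, sub_zero] at h3

/-- The derivative is even and the value at 0 is 0, as `exp 0 = 1` makes the two integrals cancel.
-/
theorem spaceVar_neg (z : ℝ) : spaceVar (-z) = -spaceVar z := by
  have h : ∀ z, HasDerivAt (fun z => spaceVar z + spaceVar (-z)) 0 z := fun z =>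
    ((hasDerivAt_spaceVar z).add ((hasDerivAt_spaceVar (-z)).scomp z (hasDerivAt_neg z))).congr_deriv
      (by simp [orbitPos_neg])
  have := is_const_of_deriv_eq_zero (fun z => (h z).differentiableAt) (fun z => (h z).deriv) z 0
  have h0 : spaceVar 0 = 0 := by simp [spaceVar, halfWidth]
  simp [h0] at this
  linarith

theorem tendsto_spaceVar_atBot : Tendsto spaceVar atBot (𝓝 (-halfWidth)) := by
  have := (tendsto_spaceVar_atTop.comp tendsto_neg_atBot_atTop).neg
  exact this.congr fun z => by simp [spaceVar_neg]

theorem two_mul_halfWidth_mem :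
    halfWidth - -halfWidth ∈ Icc (5.7503277707 : ℝ) 5.8115725019 := by
  obtain ⟨h1, h2⟩ := integral_widthDensity_bounds
  obtain ⟨h3, h4⟩ := sqrt_three_tenths_mem
  have hk : 0 < √(0.3 : ℝ) := by positivity
  rw [show halfWidth - -halfWidth = (8 * ∫ t in (0 : ℝ)..1, widthDensity t) / √0.3 by
    rw [halfWidth]; ring]
  constructor
  · rw [le_div_iff₀ hk]; linarith
  · rw [div_le_iff₀ hk]; linarith

/-! ### Functions transported along a change of variables and extended by zero -/

section Extend

variable {X X' : ℝ → ℝ} {a b : ℝ} (hX : ∀ z, HasDerivAt X (X' z) z) (hX' : Continuous X')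
  (hpos : ∀ z, 0 < X' z) (hbot : Tendsto X atBot (𝓝 a)) (htop : Tendsto X atTop (𝓝 b))
include hX hpos

theorem range_eq_Ioo_of_hasDerivAt (hbot : Tendsto X atBot (𝓝 a)) (htop : Tendsto X atTop (𝓝 b)) :
    range X = Ioo a b := by
  have hmono := strictMono_of_hasDerivAt_pos hX hpos
  refine Subset.antisymm ?_ fun ξ hξ => ?_
  · rintro _ ⟨z, rfl⟩
    exact ⟨(hmono.monotone.le_of_tendsto hbot (z - 1)).trans_lt (hmono (by linarith)),
      (hmono (by linarith)).trans_le (hmono.monotone.ge_of_tendsto htop (z + 1))⟩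
  · obtain ⟨z, hz⟩ := (hbot.eventually (gt_mem_nhds hξ.1)).exists
    obtain ⟨w, hw⟩ := (htop.eventually (lt_mem_nhds hξ.2)).exists
    exact mem_range_of_exists_le_of_exists_ge
      (continuous_iff_continuousAt.2 fun z => (hX z).continuousAt) ⟨z, hz.le⟩ ⟨w, hw.le⟩

include hX'

/-- Inside the range, `X` is a local homeomorphism. At a point outside it, `A` is small off a
compact `K`, and the complement of the compact set `X '' K` is a neighbourhood of that point. -/
theorem continuous_extend_zero {A : ℝ → ℝ} (hA : Continuous A)
    (hA0 : Tendsto A (cocompact ℝ) (𝓝 0)) : Continuous (Function.extend X A 0) := by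
  have hinj := (strictMono_of_hasDerivAt_pos hX hpos).injective
  refine continuous_iff_continuousAt.2 fun ξ => ?_
  by_cases hξ : ∃ z, X z = ξ
  · obtain ⟨z, rfl⟩ := hξ
    have hs : HasStrictDerivAt X (X' z) z :=
      hasStrictDerivAt_of_hasDerivAt_of_continuousAt (.of_forall hX) hX'.continuousAt
    rw [ContinuousAt, hinj.extend_apply, ← hs.map_nhds_eq (hpos z).ne', tendsto_map'_iff,
      Function.extend_comp hinj]
    exact hA.continuousAt
  · rw [ContinuousAt, Function.extend_apply' _ _ _ hξ, Metric.tendsto_nhds]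
    intro ε hε
    have h1 : ∀ᶠ z in cocompact ℝ, dist (A z) 0 < ε := hA0.eventually (Metric.ball_mem_nhds 0 hε)
    obtain ⟨K, hK, hKs⟩ := mem_cocompact.1 h1
    have h2 : IsClosed (X '' K) :=
      (hK.image (continuous_iff_continuousAt.2 fun z => (hX z).continuousAt)).isClosed
    have h3 : ξ ∉ X '' K := fun ⟨z, _, hz⟩ => hξ ⟨z, hz⟩
    filter_upwards [h2.isOpen_compl.mem_nhds h3] with y hy
    by_cases hy' : ∃ z, X z = y
    · obtain ⟨z, rfl⟩ := hy'
      rw [hinj.extend_apply]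
      exact hKs fun hz => hy ⟨z, hz, rfl⟩
    · rw [Function.extend_apply' _ _ _ hy']
      simpa using hε

include hbot htop

/-- The extension of `A` is the primitive `J` from `a` of the continuous extension of `B`: `J ∘ X -
A` is constant and vanishes at `-∞`, and the decay of `A` at `+∞` forces `J b = 0`. This gives
differentiability at the two edges as well. -/
theorem hasDerivAt_extend_zero {A B : ℝ → ℝ} (hA : ∀ z, HasDerivAt A (B z * X' z) z)
    (hB : Continuous B) (hA0 : Tendsto A (cocompact ℝ) (𝓝 0))
    (hB0 : Tendsto B (cocompact ℝ) (𝓝 0)) (ξ : ℝ) :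
    HasDerivAt (Function.extend X A 0) (Function.extend X B 0 ξ) ξ := by
  have hinj := (strictMono_of_hasDerivAt_pos hX hpos).injective
  have hr := range_eq_Ioo_of_hasDerivAt hX hpos hbot htop
  have hc := continuous_extend_zero hX hX' hpos hB hB0
  have hJ : ∀ ξ, HasDerivAt (fun x => ∫ s in a..x, Function.extend X B 0 s)
      (Function.extend X B 0 ξ) ξ := fun ξ =>
    intervalIntegral.integral_hasDerivAt_right (hc.intervalIntegrable _ _)
      (hc.stronglyMeasurableAtFilter _ _) hc.continuousAt
  set J : ℝ → ℝ := fun x => ∫ s in a..x, Function.extend X B 0 s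
  rw [cocompact_eq_atBot_atTop, tendsto_sup] at hA0
  have hout : ∀ y, y ∉ Ioo a b → Function.extend X B 0 y = 0 := fun y hy =>
    Function.extend_apply' _ _ _ fun h => hy (hr ▸ h)
  have hJa : J a = 0 := intervalIntegral.integral_same
  have hJX : ∀ z, J (X z) = A z := by
    have hd : ∀ z, HasDerivAt (fun z => J (X z) - A z) 0 z := fun z =>
      (((hJ (X z)).comp z (hX z)).sub (hA z)).congr_deriv (by rw [hinj.extend_apply]; ring)
    have hconst := is_const_of_deriv_eq_zero (fun z => (hd z).differentiableAt)
      fun z => (hd z).deriv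
    intro z
    have hl : Tendsto (fun z => J (X z) - A z) atBot (𝓝 (J a - 0)) :=
      ((hJ a).continuousAt.tendsto.comp hbot).sub hA0.1
    have := tendsto_nhds_unique (tendsto_const_nhds.congr fun w => hconst z w) hl
    simp only [hJa] at this
    linarith
  have hJb : J b = 0 := tendsto_nhds_unique ((hJ b).continuousAt.tendsto.comp htop)
    (hA0.2.congr fun z => (hJX z).symm)
  have hEJ : Function.extend X A 0 = J := by
    ext y
    by_cases hy : y ∈ Ioo a b
    · rw [← hr] at hy
      obtain ⟨z, rfl⟩ := hy
      rw [hinj.extend_apply, hJX]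
    · rw [Function.extend_apply' _ _ _ fun h => hy (hr ▸ h)]
      simp only [mem_Ioo, not_and_or, not_lt] at hy
      rcases hy with hy | hy
      · have : J y = ∫ s in a..y, (0 : ℝ) := intervalIntegral.integral_congr fun s hs => by
          rw [uIcc_of_ge hy] at hs
          exact hout s fun h => absurd h.1 hs.2.not_gt
        simp [this]
      · have h1 : J y = J b + ∫ s in b..y, Function.extend X B 0 s :=
          (intervalIntegral.integral_add_adjacent_intervals (hc.intervalIntegrable _ _)
            (hc.intervalIntegrable _ _)).symm
        have h2 : ∫ s in b..y, Function.extend X B 0 s = ∫ s in b..y, (0 : ℝ) :=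
          intervalIntegral.integral_congr fun s hs => by
            rw [uIcc_of_le hy] at hs
            exact hout s fun h => absurd h.2 hs.1.not_gt
        simp [h1, h2, hJb]
  rw [hEJ]
  exact hJ ξ

end Extend

/-! ### Stationary weak solutions -/

theorem setIntegral_Ioo_eq_intervalIntegral {g : ℝ → ℝ} {a b : ℝ} (h : a ≤ b) :
    ∫ x in Ioo a b, g x = ∫ x in a..b, g x := by
  rw [intervalIntegral.integral_of_le h, integral_Ioc_eq_integral_Ioo]

theorem continuousOn_slice {g : ℝ × ℝ → ℝ} {T t : ℝ} (ht : t ∈ Icc 0 T)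
    (hg : ContinuousOn g (Icc 0 T ×ˢ univ)) : Continuous fun x => g (t, x) :=
  continuousOn_univ.1 (hg.comp (by fun_prop) fun _ _ => ⟨ht, trivial⟩)

/-- Only `φ^(m+1)` has to be twice differentiable, not `φ`. The `ηt` term integrates exactly in `t`,
and the remaining terms integrate exactly in `x`. -/
theorem isWeakSolution_stationary {m : ℝ} {f φ W : ℝ → ℝ} (hm : m + 1 ≠ 0) (hφ : Continuous φ)
    (hφ01 : ∀ x, φ x ∈ Icc (0 : ℝ) 1)
    (hW : ∀ x, HasDerivAt (fun x => φ x ^ (m + 1)) (W x) x)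
    (hW' : ∀ x, HasDerivAt W (-((m + 1) * f (φ x))) x) (hf : Continuous fun x => f (φ x)) :
    IsWeakSolution m f φ fun t x => φ (x - 0 * t) where
  init_cont := hφ
  init_mem := hφ01
  nonneg := fun t _ x => (hφ01 _).1
  cont := fun T _ => by fun_prop
  bounded := fun T _ => ⟨1, fun t _ x => abs_le.2 ⟨by linarith [(hφ01 (x - 0 * t)).1], (hφ01 _).2⟩⟩
  weak := fun r T hr hT η ηt ηx ηxx hη => by
    simp only [zero_mul, sub_zero]
    have hP : Continuous fun x => φ x ^ (m + 1) :=
      continuous_iff_continuousAt.2 fun x => (hW x).continuousAt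
    have hint : ∀ g : ℝ × ℝ → ℝ, ContinuousOn g (Icc 0 T ×ˢ univ) →
        IntegrableOn g (Ioo 0 T ×ˢ Ioo (-r) r) := fun g hg =>
      ((hg.mono (prod_mono_right (subset_univ (Icc (-r) r)))).integrableOn_compact
        (isCompact_Icc.prod isCompact_Icc)).mono_set
        (prod_mono Ioo_subset_Icc_self Ioo_subset_Icc_self)
    have i1 := hint (fun q => φ q.2 * ηt q) ((hφ.comp continuous_snd).continuousOn.mul hη.cont_t)
    have i2 := hint (fun q => 1 / (m + 1) * φ q.2 ^ (m + 1) * ηxx q + f (φ q.2) * η q)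
      (((continuous_const.mul (hP.comp continuous_snd)).continuousOn.mul hη.cont_xx).add
        ((hf.comp continuous_snd).continuousOn.mul hη.cont))
    have e1 : ∫ q in Ioo 0 T ×ˢ Ioo (-r) r, φ q.2 * ηt q
        = ∫ x in (-r)..r, (φ x * η (T, x) - φ x * η (0, x)) := by
      rw [Measure.volume_eq_prod] at i1 ⊢
      rw [setIntegral_prod _ i1]
      rw [IntegrableOn, ← Measure.prod_restrict] at i1
      rw [integral_integral_swap (f := fun t x => φ x * ηt (t, x)) i1,
        setIntegral_Ioo_eq_intervalIntegral (by linarith)]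
      refine intervalIntegral.integral_congr fun x _ => ?_
      rw [setIntegral_Ioo_eq_intervalIntegral hT.le, intervalIntegral.integral_const_mul, ← mul_sub]
      congr 1
      have hsl : ∀ g : ℝ × ℝ → ℝ, ContinuousOn g (Icc 0 T ×ˢ univ) →
          ContinuousOn (fun t => g (t, x)) (Icc 0 T) := fun g hg =>
        hg.comp (by fun_prop) fun t ht => ⟨ht, trivial⟩
      refine intervalIntegral.integral_eq_sub_of_hasDerivAt_of_le (f := fun t => η (t, x)) hT.le
        (hsl η hη.cont) (fun t ht => ?_) ?_
      · exact (hη.deriv_t t (Ioo_subset_Icc_self ht) x).hasDerivAt (Icc_mem_nhds ht.1 ht.2)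
      · exact (by simpa [uIcc_of_le hT.le] using hsl ηt hη.cont_t :
          ContinuousOn (fun t => ηt (t, x)) (uIcc 0 T)).intervalIntegrable
    have e2 : ∫ q in Ioo 0 T ×ˢ Ioo (-r) r,
          (1 / (m + 1) * φ q.2 ^ (m + 1) * ηxx q + f (φ q.2) * η q)
        = 1 / (m + 1) *
          ∫ t in (0)..T, (φ r ^ (m + 1) * ηx (t, r) - φ (-r) ^ (m + 1) * ηx (t, -r)) := by
      rw [Measure.volume_eq_prod] at i2 ⊢
      rw [setIntegral_prod _ i2, setIntegral_Ioo_eq_intervalIntegral hT.le,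
        ← intervalIntegral.integral_const_mul]
      refine intervalIntegral.integral_congr fun t ht => ?_
      rw [uIcc_of_le hT.le] at ht
      simp only
      rw [setIntegral_Ioo_eq_intervalIntegral (by linarith)]
      -- Green's formula: differentiating, the `W ηx` terms cancel and the equation for `W'`
      -- produces `f η`. The term `W η` vanishes at `±r`.
      have hd : ∀ x ∈ uIcc (-r) r, HasDerivAt
          (fun x => 1 / (m + 1) * (φ x ^ (m + 1) * ηx (t, x) - W x * η (t, x)))
          (1 / (m + 1) * φ x ^ (m + 1) * ηxx (t, x) + f (φ x) * η (t, x)) x := fun x _ =>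
        ((((hW x).mul (hη.deriv_xx t ht x)).sub ((hW' x).mul (hη.deriv_x t ht x))).const_mul
          (1 / (m + 1))).congr_deriv (by field_simp; ring)
      rw [intervalIntegral.integral_eq_sub_of_hasDerivAt hd]
      · rw [hη.vanish_right t ht, hη.vanish_left t ht]; ring
      · exact (((continuous_const.mul hP).mul (continuousOn_slice ht hη.cont_xx)).add
          (hf.mul (continuousOn_slice ht hη.cont))).intervalIntegrable _ _
    rw [← e1, ← e2, ← integral_add i1 i2]
    simp only [add_assoc]

/-! ### The compacton -/

theorem comp_extend_zero {X A h : ℝ → ℝ} (hX : Function.Injective X) (h0 : h 0 = 0) :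
    (fun ξ => h (Function.extend X A 0 ξ)) = Function.extend X (fun z => h (A z)) 0 := by
  ext ξ
  by_cases hξ : ∃ z, X z = ξ
  · obtain ⟨z, rfl⟩ := hξ
    rw [hX.extend_apply, hX.extend_apply]
  · rw [Function.extend_apply' _ _ _ hξ, Function.extend_apply' _ _ _ hξ]
    simpa using h0

/-- The profile of the compacton in the original space variable. -/
noncomputable def compactonProfile : ℝ → ℝ := Function.extend spaceVar orbitPos 0

theorem continuous_orbitPos : Continuous orbitPos :=
  continuous_iff_continuousAt.2 fun z => (hasDerivAt_orbitPos z).continuousAt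

theorem continuous_orbitVel : Continuous orbitVel :=
  continuous_iff_continuousAt.2 fun z => (hasDerivAt_orbitVel z).continuousAt

theorem tendsto_orbitPos_cocompact : Tendsto orbitPos (cocompact ℝ) (𝓝 0) := by
  rw [cocompact_eq_atBot_atTop]
  exact tendsto_orbitPos_atBot.sup tendsto_orbitPos_atTop

theorem rpow_orbitPos_pos (z s : ℝ) : 0 < orbitPos z ^ s :=
  Real.rpow_pos_of_pos (orbitPos_pos z) s

theorem continuous_rpow_orbitPos (s : ℝ) : Continuous fun z => orbitPos z ^ s :=
  continuous_orbitPos.rpow_const fun z => .inl (orbitPos_pos z).ne'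

theorem spaceVar_injective : Function.Injective spaceVar :=
  (strictMono_of_hasDerivAt_pos hasDerivAt_spaceVar fun z => rpow_orbitPos_pos z _).injective

theorem range_spaceVar : range spaceVar = Ioo (-halfWidth) halfWidth :=
  range_eq_Ioo_of_hasDerivAt hasDerivAt_spaceVar (fun z => rpow_orbitPos_pos z _)
    tendsto_spaceVar_atBot tendsto_spaceVar_atTop

theorem compactonProfile_spaceVar (z : ℝ) : compactonProfile (spaceVar z) = orbitPos z :=
  spaceVar_injective.extend_apply _ _ _

theorem compactonProfile_eq_zero {ξ : ℝ} (h : ξ ∉ Ioo (-halfWidth) halfWidth) :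
    compactonProfile ξ = 0 :=
  Function.extend_apply' _ _ _ fun h' => h (range_spaceVar ▸ h')

theorem compactonProfile_mem (ξ : ℝ) : compactonProfile ξ ∈ Icc (0 : ℝ) 1 := by
  by_cases h : ξ ∈ Ioo (-halfWidth) halfWidth
  · rw [← range_spaceVar] at h
    obtain ⟨z, rfl⟩ := h
    rw [compactonProfile_spaceVar]
    exact ⟨(orbitPos_pos z).le, orbitPos_le_one z⟩
  · simp [compactonProfile_eq_zero h]

theorem support_compactonProfile :
    Function.support compactonProfile = Ioo (-halfWidth) halfWidth := by
  refine Subset.antisymm (fun ξ h => by_contra fun h' => h (compactonProfile_eq_zero h')) ?_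
  rw [← range_spaceVar]
  rintro _ ⟨z, rfl⟩
  rw [Function.mem_support, compactonProfile_spaceVar]
  exact (orbitPos_pos z).ne'

theorem tsupport_compactonProfile :
    tsupport compactonProfile = Icc (-halfWidth) halfWidth := by
  rw [tsupport, support_compactonProfile, closure_Ioo]
  have := two_mul_halfWidth_mem.1
  intro h
  linarith

theorem continuous_extend_spaceVar {A : ℝ → ℝ} (hA : Continuous A)
    (hA0 : Tendsto A (cocompact ℝ) (𝓝 0)) : Continuous (Function.extend spaceVar A 0) :=
  continuous_extend_zero hasDerivAt_spaceVar (continuous_rpow_orbitPos _)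
    (fun z => rpow_orbitPos_pos z _) hA hA0

theorem hasDerivAt_extend_spaceVar {A B : ℝ → ℝ}
    (hA : ∀ z, HasDerivAt A (B z * orbitPos z ^ (3 / 4 : ℝ)) z) (hB : Continuous B)
    (hA0 : Tendsto A (cocompact ℝ) (𝓝 0)) (hB0 : Tendsto B (cocompact ℝ) (𝓝 0)) (ξ : ℝ) :
    HasDerivAt (Function.extend spaceVar A 0) (Function.extend spaceVar B 0 ξ) ξ :=
  hasDerivAt_extend_zero hasDerivAt_spaceVar (continuous_rpow_orbitPos _)
    (fun z => rpow_orbitPos_pos z _) tendsto_spaceVar_atBot tendsto_spaceVar_atTop hA hB hA0 hB0 ξ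

theorem reaction_zero : reaction (1 / 4) 0.3 0 = 0 := by
  simp [reaction]

theorem continuous_reaction : Continuous (reaction (1 / 4) 0.3) := by
  unfold reaction
  have : Continuous fun u : ℝ => u ^ (1 / 4 : ℝ) := Real.continuous_rpow_const (by norm_num)
  fun_prop

theorem reaction_mul_rpow {u : ℝ} (hu : 0 < u) :
    reaction (1 / 4) 0.3 u * u ^ (3 / 4 : ℝ) = u * (1 - u) * (u - 0.3) := by
  have : u ^ (1 / 4 : ℝ) * u ^ (3 / 4 : ℝ) = u := by rw [← Real.rpow_add hu]; norm_num
  rw [reaction]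
  linear_combination ((1 - u) * (u - 0.3)) * this

/-- The extension lemma is used twice, from `φ^(7/4)` to `(7/4) ψ` and from there to `-(7/4) f(φ)`.
The second passage relies on `1/4 + 3/4 = 1` (`reaction_mul_rpow`). -/
theorem isCompacton_compactonProfile :
    IsCompacton (3 / 4) (reaction (1 / 4) 0.3) 0 compactonProfile := by
  have hp0 := tendsto_orbitPos_cocompact
  have hq0 := tendsto_orbitVel hp0
  have hpow : Continuous fun u : ℝ => u ^ (3 / 4 + 1 : ℝ) :=
    Real.continuous_rpow_const (by norm_num)
  have hcont : Continuous compactonProfile := continuous_extend_spaceVar continuous_orbitPos hp0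
  refine ⟨?_, ?_, fun h => (orbitPos_pos 0).ne' ?_⟩
  · refine isWeakSolution_stationary (m := 3 / 4)
      (W := Function.extend spaceVar (fun z => (3 / 4 + 1) * orbitVel z) 0) (by norm_num) hcont
      compactonProfile_mem ?_ ?_ (continuous_reaction.comp hcont)
    · rw [compactonProfile,
        comp_extend_zero (h := fun u => u ^ (3 / 4 + 1 : ℝ)) spaceVar_injective (by norm_num)]
      refine hasDerivAt_extend_spaceVar (fun z => ?_) (continuous_const.mul continuous_orbitVel) ?_ ?_
      · refine ((hasDerivAt_orbitPos z).rpow_const (p := 3 / 4 + 1)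
          (.inl (orbitPos_pos z).ne')).congr_deriv ?_
        rw [add_sub_cancel_right]
        ring
      · have := (hpow.tendsto 0).comp hp0
        rwa [Real.zero_rpow (by norm_num)] at this
      · simpa using hq0.const_mul (3 / 4 + 1)
    · have e : (fun ξ => -((3 / 4 + 1) * reaction (1 / 4) 0.3 (compactonProfile ξ))) =
          Function.extend spaceVar
            (fun z => -((3 / 4 + 1) * reaction (1 / 4) 0.3 (orbitPos z))) 0 :=
        comp_extend_zero (h := fun u => -((3 / 4 + 1) * reaction (1 / 4) 0.3 u))
          spaceVar_injective (by rw [reaction_zero, mul_zero, neg_zero])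
      intro ξ
      rw [congrFun e ξ]
      have hc : Continuous fun u => -((3 / 4 + 1) * reaction (1 / 4) 0.3 u) :=
        (continuous_const.mul continuous_reaction).neg
      refine hasDerivAt_extend_spaceVar (fun z => ?_) (hc.comp continuous_orbitPos) ?_ ?_ ξ
      · refine ((hasDerivAt_orbitVel z).const_mul (3 / 4 + 1)).congr_deriv ?_
        simp only [Function.comp_apply]
        linear_combination (-(3 / 4 + 1)) * (reaction_mul_rpow (orbitPos_pos z)).symm
      · simpa using hq0.const_mul (3 / 4 + 1)
      · have := (hc.tendsto 0).comp hp0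
        rwa [reaction_zero, mul_zero, neg_zero] at this
  · rw [HasCompactSupport, tsupport_compactonProfile]
    exact isCompact_Icc
  · rw [← compactonProfile_spaceVar, h, Pi.zero_apply]

/-! ### Assembly at speed zero -/

theorem mainTheorem7 :
    ∃ c ∈ Icc (-(1.5 / 10 ^ 6) : ℝ) (1.5 / 10 ^ 6),
    ∃ (γ : ℝ → ℝ × ℝ) (X φ : ℝ → ℝ) (ξmin ξmax : ℝ),
      -- a positive homoclinic orbit of the origin of the desingularized system
      IsHomoclinicOrbit (desingField 0.3 c) (0, 0) γ ∧ (∀ z, 0 < (γ z).1) ∧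
      -- the change of variables `dz/dξ = φ^(-3/4)` maps the `z`-line onto `(ξmin, ξmax)`
      (∀ z, HasDerivAt X ((γ z).1 ^ (3 / 4 : ℝ)) z) ∧
      Tendsto X atBot (𝓝 ξmin) ∧ Tendsto X atTop (𝓝 ξmax) ∧
      -- the wave profile in the original variable `ξ`, extended by zero
      (∀ z, φ (X z) = (γ z).1) ∧ (∀ ξ, ξ ∉ Ioo ξmin ξmax → φ ξ = 0) ∧
      -- it is a compacton traveling wave with speed `c`
      IsCompacton (3 / 4) (reaction (1 / 4) 0.3) c φ ∧
      -- size of the support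
      (∀ t, tsupport (fun x => φ (x - c * t)) = Icc (ξmin + c * t) (ξmax + c * t)) ∧
      ξmax - ξmin ∈ Icc (5.7503277707 : ℝ) 5.8115725019 ∧
      -- the isolating block around the origin, in coordinates given by eigenvectors `V₁`, `V₂`
      ∃ (l₁ l₂ : ℝ) (V₁ V₂ : ℝ × ℝ),
        l₂ < 0 ∧ 0 < l₁ ∧
        Module.End.HasEigenvector
          (fderiv ℝ (desingField 0.3 c) (0, 0) : ℝ × ℝ →ₗ[ℝ] ℝ × ℝ) l₁ V₁ ∧
        Module.End.HasEigenvector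
          (fderiv ℝ (desingField 0.3 c) (0, 0) : ℝ × ℝ →ₗ[ℝ] ℝ × ℝ) l₂ V₂ ∧
        V₁.1 ∈ Icc (0.87714184587409483 : ℝ) 0.87714960434933953 ∧
        V₁.2 ∈ Icc (0.48042765940975440 : ℝ) 0.48043734031068247 ∧
        V₂.1 ∈ Icc (-0.87714960433700939 : ℝ) (-0.87714184587344934) ∧
        V₂.2 ∈ Icc (0.48042765939685023 : ℝ) 0.48043734034727664 ∧
        (0, 0) ∈ (fun b : ℝ × ℝ => b.1 • V₁ + b.2 • V₂) ''
          (Icc (-(1.0000068275040609 / 10 ^ 6)) (1.0000038705938853 / 10 ^ 6) ×ˢ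
            Icc (-(1.0000261784559085 / 10 ^ 7)) (1.0000461805915562 / 10 ^ 7)) ∧
        IsIsolatingBlock (desingField 0.3 c)
          ((fun b : ℝ × ℝ => b.1 • V₁ + b.2 • V₂) ''
            (Icc (-(1.0000068275040609 / 10 ^ 6)) (1.0000038705938853 / 10 ^ 6) ×ˢ
              Icc (-(1.0000261784559085 / 10 ^ 7)) (1.0000461805915562 / 10 ^ 7))) := by
  obtain ⟨hl1, hl2⟩ := sqrt_three_tenths_mem
  have hl : (0 : ℝ) < √0.3 := by linarith
  have hs : (√(0.3 : ℝ)) ^ 2 = 0.3 := Real.sq_sqrt (by norm_num)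
  -- The eigenvectors are not normalized: 0.877145 lies in the prescribed ranges up to sign, and its
  -- product with `√0.3` lies in both second-component ranges.
  refine ⟨0, by constructor <;> norm_num, fun z => (orbitPos z, orbitVel z), spaceVar,
    compactonProfile, -halfWidth, halfWidth, isHomoclinicOrbit_orbit, orbitPos_pos,
    hasDerivAt_spaceVar, tendsto_spaceVar_atBot, tendsto_spaceVar_atTop, compactonProfile_spaceVar,
    fun ξ hξ => compactonProfile_eq_zero hξ, isCompacton_compactonProfile, fun t => ?_,
    two_mul_halfWidth_mem, √0.3, -√0.3, (0.877145, 0.877145 * √0.3), (-0.877145, 0.877145 * √0.3),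
    by linarith, hl, hasEigenvector_desingField_zero hs (by norm_num), ?_, ?_, ?_, ?_, ?_, ?_,
    isIsolatingBlock_desingField_numeric⟩
  · simpa using tsupport_compactonProfile
  · have := hasEigenvector_desingField_zero (a := 0.3) (l := -√0.3) (s := -0.877145)
      (by rw [neg_sq, hs]) (by norm_num)
    rwa [neg_mul_neg] at this
  · constructor <;> norm_num
  · constructor <;> dsimp only <;> linarith
  · constructor <;> norm_num
  · constructor <;> dsimp only <;> linarith
  · exact ⟨(0, 0), ⟨by constructor <;> norm_num, by constructor <;> norm_num⟩, by ext <;> simp⟩
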